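/- Let $q\in\mathbb{C}$ with $0<|q|<1$, fix a value of $\log q$, and write $q^{\beta}=e^{\beta\log q}$, $(a)_\infty=\prod_{k\ge0}(1-aq^k)$, $(a_1,\dots,a_n)_\infty=(a_1)_\infty\cdots(a_n)_\infty$ and $\theta(x)=(x,q/x)_\infty$. Let $\beta_1,\dots,\beta_M,\gamma\in\mathbb{C}$, $b_i=q^{\beta_i}$, $c=q^{\gamma}$. For $1\le r\le M-1$ let $\tilde S_r(\{b_i\},c;u)$ be the $M\times M$ matrix $$\tilde S_r=\begin{pmatrix} I_{r-1}&&&\\&\tilde S_{r,r}&\tilde S_{r,r+1}&\\&\tilde S_{r+1,r}&\tilde S_{r+1,r+1}&\\&&&I_{M-r-1}\end{pmatrix}$$ (zero in the blank places) with entries $$\tilde S_{r,r}=\frac{(q/b_{r+1},\,b_r)_\infty}{\bigl(q^2b_rb_{r+2}\cdots b_M/c,\ c/(qb_{r+1}\cdots b_M)\bigr)_\infty}\,\frac{\theta\bigl(uc/(qb_{r+1}\cdots b_M)\bigr)}{\theta(ub_r)}\,u^{-1-\sum_{i=r}^M\beta_i+\gamma},$$ $$\tilde S_{r,r+1}=\frac{(q^2b_{r+2}\cdots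 b_M/c,\ qb_r\cdots b_M/c)_\infty}{(q^2b_rb_{r+2}\cdots b_M/c,\ qb_{r+1}\cdots b_M/c)_\infty}\,\frac{\theta(u)}{\theta(ub_r)}\,u^{-\beta_r},$$ $$\tilde S_{r+1,r}=\frac{\bigl(c/(b_r\cdots b_M),\ c/(qb_{r+2}\cdots b_M)\bigr)_\infty}{\bigl(c/(b_rb_{r+2}\cdots b_M),\ c/(qb_{r+1}\cdots b_M)\bigr)_\infty}\,\frac{\theta(ub_r/b_{r+1})}{\theta(ub_r)}\,u^{-\beta_{r+1}},$$ $$\tilde S_{r+1,r+1}=\frac{(q/b_r,\,b_{r+1})_\infty}{\bigl(c/(b_rb_{r+2}\cdots b_M),\ qb_{r+1}\cdots b_M/c\bigr)_\infty}\,\frac{\theta(uqb_rb_{r+2}\cdots b_M/c)}{\theta(ub_r)}\,u^{1+\sum_{i=r+2}^M\beta_i-\gamma}.$$ Here powers are taken with respect to a chosen logarithm, $u^\delta=e^{\delta\log u}$. Assume $c/\prod_{i\in I}b_i\notin q^{\mathbb{Z}}$ for every $I\subseteq\{1,\dots,M\}$. Let $1\le r\le M-2$, let $s_r=(r,r+1)$,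 and for a permutation $\sigma$ of $\{1,\dots,M\}$ write $b_\sigma=\{b_{\sigma(i)}\}_{1\le i\le M}$ (with exponents $\beta_{\sigma(i)}$). Products of permutations are read from left to right, so that $(s_{r+1}s_r)(i)=s_r(s_{r+1}(i))$. Then the Yang–Baxter equation $$\tilde S_r(b_{s_{r+1}s_r},c;u)\,\tilde S_{r+1}(b_{s_r},c;uv)\,\tilde S_r(b,c;v)=\tilde S_{r+1}(b_{s_rs_{r+1}},c;v)\,\tilde S_r(b_{s_{r+1}},c;uv)\,\tilde S_{r+1}(b,c;u)$$ holds for all nonzero $u,v\in\mathbb{C}$ at which none of these matrices has a pole, that is, $ub_{r+1},\ vb_r,\ uvb_r\notin q^{\mathbb{Z}}$, for every choice of $\log u$ and $\log v$, with $\log(uv)=\log u+\log v$. -/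

import Mathlib

noncomputable section

/-- The infinite `q`-shifted factorial `(a)_∞ = ∏_{k ≥ 0} (1 - a q^k)`. -/
def qPoch (q a : ℂ) : ℂ := ∏' k : ℕ, (1 - a * q ^ k)

/-- The theta function `θ(x) = (x)_∞ (q/x)_∞`. -/
def qTheta (q x : ℂ) : ℂ := qPoch q x * qPoch q (q / x)

/-- The power `q ^ β = exp (β log q)`, where `lq` is the chosen value of `log q`. -/
def qPow (lq β : ℂ) : ℂ := Complex.exp (lq * β)

/-- The adjacent transposition `s_r`, exchanging the positions `r` and `r + 1`
(positions are counted from `0`). -/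
def adjSwap {M : ℕ} (r : ℕ) (hr : r + 1 < M) : Equiv.Perm (Fin M) :=
  Equiv.swap ⟨r, by omega⟩ ⟨r + 1, hr⟩

/-- The matrix `S̃_r({b_i}, c; u)` of size `M` with `b_i = q ^ β_i`, `c = q ^ γ`.
The entries contain complex powers of `u`, so the matrix is a function of a logarithm `x` of `u`:
`u = exp x` and `u ^ δ = exp (δ x)`. Positions are counted from `0`; the `2 × 2` block sits in the
rows and columns `r`, `r + 1`, and the matrix is the identity elsewhere. Below, `b₀`, `b₁` are
the parameters at the positions `r`, `r + 1`, while `p` and `s` are the product of the `b_i` and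
the sum of the `β_i` over all positions `i` after `r + 1`. -/
def STilde {M : ℕ} (lq : ℂ) (β : Fin M → ℂ) (γ : ℂ) (r : ℕ) (hr : r + 1 < M) (x : ℂ) :
    Matrix (Fin M) (Fin M) ℂ :=
  let q : ℂ := Complex.exp lq
  let c : ℂ := qPow lq γ
  let u : ℂ := Complex.exp x
  let β₀ : ℂ := β ⟨r, by omega⟩
  let β₁ : ℂ := β ⟨r + 1, hr⟩
  let b₀ : ℂ := qPow lq β₀
  let b₁ : ℂ := qPow lq β₁
  let p : ℂ := ∏ i : Fin M with r + 1 < i.val, qPow lq (β i)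
  let s : ℂ := ∑ i : Fin M with r + 1 < i.val, β i
  Matrix.of fun i j =>
    if i.val = r ∧ j.val = r then
      (qPoch q (q / b₁) * qPoch q b₀) /
          (qPoch q (q ^ 2 * b₀ * p / c) * qPoch q (c / (q * b₁ * p))) *
        (qTheta q (u * c / (q * b₁ * p)) / qTheta q (u * b₀)) *
        Complex.exp ((-1 - (β₀ + β₁ + s) + γ) * x)
    else if i.val = r ∧ j.val = r + 1 then
      (qPoch q (q ^ 2 * p / c) * qPoch q (q * b₀ * b₁ * p / c)) /
          (qPoch q (q ^ 2 * b₀ * p / c) * qPoch q (q * b₁ * p / c)) *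
        (qTheta q u / qTheta q (u * b₀)) *
        Complex.exp (-β₀ * x)
    else if i.val = r + 1 ∧ j.val = r then
      (qPoch q (c / (b₀ * b₁ * p)) * qPoch q (c / (q * p))) /
          (qPoch q (c / (b₀ * p)) * qPoch q (c / (q * b₁ * p))) *
        (qTheta q (u * b₀ / b₁) / qTheta q (u * b₀)) *
        Complex.exp (-β₁ * x)
    else if i.val = r + 1 ∧ j.val = r + 1 then
      (qPoch q (q / b₀) * qPoch q b₁) /
          (qPoch q (c / (b₀ * p)) * qPoch q (q * b₁ * p / c)) *
        (qTheta q (u * q * b₀ * p / c) / qTheta q (u * b₀)) *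
        Complex.exp ((1 + s - γ) * x)
    else if i = j then 1
    else 0

end

/-!
The function `σ z = q ^ (-z / 2) θ(q ^ z)` is odd. By the Jacobi triple product it is a theta
series, and regrouping the product of two such series according to the parity of the sum of the
indices gives `σ (x + y) σ (x - y) = f x g y - g x f y`, a `2 × 2` determinant; the vanishing of a
`4 × 4` determinant with repeated rows then amounts to Weierstrass's three-term identity for `σ`.

Written in the exponents of `b_i`, `c` and `u`, the entries of `S̃_r` are quotients of values of `σ`
and of its two infinite products. Comparing the entries of the Yang-Baxter equation, the corners
`(0, 2)` and `(2, 0)` reduce to an identity of prefactors, the centre is a combination of two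
three-term identities, and every other entry is a single one. Interchanging the two infinite
products while replacing `e` by `b₀ + b₁ - e` exchanges the diagonal entries of a block, which
deduces the entries `(1, 2)`, `(2, 1)`, `(2, 2)` from `(0, 1)`, `(1, 0)`, `(0, 0)`.
-/

open Complex Filter Topology

section QPochhammer

variable {q : ℂ}

theorem summable_norm_neg_mul_pow (hq : ‖q‖ < 1) (a : ℂ) :
    Summable fun k : ℕ => ‖-(a * q ^ k)‖ := by
  simp only [norm_neg, norm_mul, norm_pow]
  exact (summable_geometric_of_lt_one (norm_nonneg _) hq).mul_left _

theorem multipliable_one_sub_mul_pow (hq : ‖q‖ < 1) (a : ℂ) :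
    Multipliable fun k : ℕ => 1 - a * q ^ k := by
  simpa only [sub_eq_add_neg] using
    multipliable_one_add_of_summable (summable_norm_neg_mul_pow hq a)

theorem prod_range_mul_qPoch (hq : ‖q‖ < 1) (a : ℂ) (n : ℕ) :
    (∏ k ∈ Finset.range n, (1 - a * q ^ k)) * qPoch q (a * q ^ n) = qPoch q a := by
  have shift (k : ℕ) : 1 - a * q ^ n * q ^ k = 1 - a * q ^ (k + n) := by ring
  have tail : Multipliable fun k : ℕ => 1 - a * q ^ (k + n) :=
    (multipliable_one_sub_mul_pow hq (a * q ^ n)).congr shift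
  simp only [qPoch, shift]
  exact tail.prod_mul_tprod_nat_mul' (f := fun k => 1 - a * q ^ k)

theorem one_sub_mul_qPoch (hq : ‖q‖ < 1) (a : ℂ) : (1 - a) * qPoch q (a * q) = qPoch q a := by
  simpa using prod_range_mul_qPoch hq a 1

theorem qPoch_eq_zero_iff (hq : ‖q‖ < 1) {a : ℂ} : qPoch q a = 0 ↔ ∃ k : ℕ, a * q ^ k = 1 := by
  constructor
  · contrapose!
    intro h
    have factor_ne_zero (k : ℕ) : 1 + -(a * q ^ k) ≠ 0 := by
      rw [← sub_eq_add_neg, sub_ne_zero]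
      exact (h k).symm
    simpa only [qPoch, sub_eq_add_neg] using
      tprod_one_add_ne_zero_of_summable factor_ne_zero (summable_norm_neg_mul_pow hq a)
  · rintro ⟨k, hk⟩
    rw [← prod_range_mul_qPoch hq a (k + 1), Finset.prod_range_succ, hk]
    simp only [sub_self, mul_zero, zero_mul]

theorem tendsto_prod_range_qPoch (hq : ‖q‖ < 1) (a : ℂ) :
    Tendsto (fun n => ∏ k ∈ Finset.range n, (1 - a * q ^ k)) atTop (𝓝 (qPoch q a)) :=
  (multipliable_one_sub_mul_pow hq a).hasProd.tendsto_prod_nat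

theorem pow_ne_one_of_norm_lt_one (hq : ‖q‖ < 1) {n : ℕ} (hn : n ≠ 0) : q ^ n ≠ 1 := fun h =>
  (pow_lt_one₀ (norm_nonneg q) hq hn).ne (by rw [← norm_pow, h, norm_one])

end QPochhammer

section QPow

variable (lq : ℂ)

theorem qPow_zero : qPow lq 0 = 1 := by simp [qPow]

theorem qPow_one : qPow lq 1 = exp lq := by simp [qPow]

theorem qPow_ne_zero (z : ℂ) : qPow lq z ≠ 0 := exp_ne_zero _

theorem qPow_add (z w : ℂ) : qPow lq (z + w) = qPow lq z * qPow lq w := by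
  simp only [qPow, mul_add, exp_add]

theorem qPow_sub (z w : ℂ) : qPow lq (z - w) = qPow lq z / qPow lq w := by
  simp only [qPow, mul_sub, exp_sub]

theorem qPow_neg (z : ℂ) : qPow lq (-z) = (qPow lq z)⁻¹ := by
  simp only [qPow, mul_neg, exp_neg]

theorem qPow_intCast (n : ℤ) : qPow lq n = exp lq ^ n := by
  rw [qPow, mul_comm, exp_int_mul]

theorem qPow_natCast (n : ℕ) : qPow lq n = exp lq ^ n := by
  exact_mod_cast qPow_intCast lq n

theorem qPow_natCast_ne_one {lq : ℂ} (hq : ‖exp lq‖ < 1) {n : ℕ} (hn : n ≠ 0) :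
    qPow lq n ≠ 1 := by
  rw [qPow_natCast]
  exact pow_ne_one_of_norm_lt_one hq hn

theorem qPow_div_self {lq : ℂ} (hq : ‖exp lq‖ < 1) (x : ℂ) : qPow lq (x / lq) = exp x := by
  have lq_ne_zero : lq ≠ 0 := by
    rintro rfl
    simp at hq
  rw [qPow, mul_div_cancel₀ _ lq_ne_zero]

theorem qPow_sum {ι : Type*} (s : Finset ι) (f : ι → ℂ) :
    qPow lq (∑ i ∈ s, f i) = ∏ i ∈ s, qPow lq (f i) := by
  simp only [qPow, Finset.mul_sum, exp_sum]

end QPow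

section TripleProduct

variable {lq : ℂ}

/-- The tail `(q^{m+1})_∞` of the product `(q)_∞`, where `q = exp lq`. It vanishes for `m < 0`, so
that `(q)_∞⁻¹ (q^{m+1})_∞` is the reciprocal of the `q`-factorial `(q)_m` extended by zero to
negative `m`. -/
noncomputable def qPochTail (lq : ℂ) (m : ℤ) : ℂ := qPoch (exp lq) (qPow lq (m + 1))

theorem qPochTail_sub_one (hq : ‖exp lq‖ < 1) (m : ℤ) :
    qPochTail lq (m - 1) = (1 - qPow lq m) * qPochTail lq m := by
  have h : qPow lq (m + 1) = qPow lq m * exp lq := by rw [qPow_add, qPow_one]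
  rw [qPochTail, qPochTail, h, one_sub_mul_qPoch hq]
  push_cast
  rw [sub_add_cancel]

theorem qPochTail_zero : qPochTail lq 0 = qPoch (exp lq) (exp lq) := by
  simp only [qPochTail, Int.cast_zero, zero_add, qPow_one]

theorem qPochTail_eq_zero (hq : ‖exp lq‖ < 1) {m : ℤ} (hm : m < 0) : qPochTail lq m = 0 := by
  refine (qPoch_eq_zero_iff hq).mpr ⟨(-(m + 1)).toNat, ?_⟩
  rw [← qPow_natCast, ← qPow_add, ← Int.cast_natCast, Int.toNat_of_nonneg (by omega)]
  push_cast
  rw [add_neg_cancel, qPow_zero]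

theorem qPochTail_zero_ne_zero (hq : ‖exp lq‖ < 1) : qPochTail lq 0 ≠ 0 := by
  rw [qPochTail_zero, ne_eq, qPoch_eq_zero_iff hq]
  rintro ⟨k, hk⟩
  exact pow_ne_one_of_norm_lt_one hq k.succ_ne_zero (by rwa [pow_succ'])

theorem tendsto_qPochTail (hq : ‖exp lq‖ < 1) : Tendsto (qPochTail lq) atTop (𝓝 1) := by
  have split (n : ℕ) :
      (∏ k ∈ Finset.range n, (1 - exp lq * exp lq ^ k)) * qPochTail lq n = qPochTail lq 0 := by
    rw [qPochTail_zero, ← prod_range_mul_qPoch hq (exp lq) n, qPochTail, Int.cast_natCast,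
      qPow_add, qPow_one, qPow_natCast, mul_comm (exp lq)]
  have h₀ := qPochTail_zero_ne_zero hq
  have products := tendsto_prod_range_qPoch hq (exp lq)
  rw [← qPochTail_zero] at products
  rw [← Nat.map_cast_int_atTop, tendsto_map'_iff, ← mul_inv_cancel₀ h₀]
  refine ((products.inv₀ h₀).const_mul (qPochTail lq 0)).congr fun n => ?_
  have prod_ne_zero := left_ne_zero_of_mul ((split n).trans_ne h₀)
  rw [← split n, Function.comp_apply]
  field_simp

theorem exists_norm_qPochTail_le (hq : ‖exp lq‖ < 1) : ∃ K, ∀ m : ℤ, ‖qPochTail lq m‖ ≤ K := by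
  obtain ⟨K, hK⟩ := (Metric.isBounded_range_of_tendsto _
    ((tendsto_qPochTail hq).comp tendsto_natCast_atTop_atTop)).exists_norm_le
  refine ⟨K, fun m => ?_⟩
  rcases lt_or_ge m 0 with h | h
  · rw [qPochTail_eq_zero hq h, norm_zero]
    exact (norm_nonneg _).trans (hK _ ⟨0, rfl⟩)
  · lift m to ℕ using h
    exact hK _ ⟨m, rfl⟩

/-- The term `(-1)^j q^{j(j-1)/2} x^j` of the theta series at `x = q^z`, where `q = exp lq`. -/
noncomputable def thetaTerm (lq z : ℂ) (j : ℤ) : ℂ := (-1) ^ j * qPow lq (j * (j - 1) / 2 + j * z)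

theorem thetaTerm_add_one (lq z : ℂ) (j : ℤ) :
    thetaTerm lq z (j + 1) = -(qPow lq (j + z) * thetaTerm lq z j) := by
  have exponent : ((j + 1 : ℤ) : ℂ) * ((j + 1 : ℤ) - 1) / 2 + (j + 1 : ℤ) * z =
      (j + z) + (j * (j - 1) / 2 + j * z) := by push_cast; ring
  rw [thetaTerm, thetaTerm, exponent, qPow_add, zpow_add_one₀ (by norm_num)]
  ring

theorem qPow_mul_thetaTerm_sub_one (lq z : ℂ) (j : ℤ) :
    qPow lq z * thetaTerm lq z (j - 1) = -(qPow lq (1 - j) * thetaTerm lq z j) := by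
  have h := thetaTerm_add_one lq z (j - 1)
  have exponent : (1 - j : ℂ) + ((j - 1 : ℤ) + z) = z := by push_cast; ring
  rw [sub_add_cancel] at h
  rw [h, mul_neg, neg_neg, ← mul_assoc, ← qPow_add, exponent]

theorem qPow_neg_mul_thetaTerm_add_one (lq z : ℂ) (j : ℤ) :
    qPow lq (-z) * thetaTerm lq z (j + 1) = -(qPow lq j * thetaTerm lq z j) := by
  have exponent : (-z : ℂ) + (j + z) = j := by ring
  rw [thetaTerm_add_one, mul_neg, ← mul_assoc, ← qPow_add, exponent]

theorem qPochTail_mul_qPochTail_recurrence (hq : ‖exp lq‖ < 1) (a b : ℤ) :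
    (1 + qPow lq (a + b + 1)) * (qPochTail lq a * qPochTail lq b) +
        qPow lq (b + 1) * (qPochTail lq (a - 1) * qPochTail lq (b + 1)) +
        qPow lq (a + 1) * (qPochTail lq (a + 1) * qPochTail lq (b - 1)) =
      (1 - qPow lq (a + b + 1)) * (1 - qPow lq (a + b + 2)) *
        (qPochTail lq (a + 1) * qPochTail lq (b + 1)) := by
  have raise (m : ℤ) : qPochTail lq m = (1 - qPow lq m * exp lq) * qPochTail lq (m + 1) := by
    simpa [qPow_add, qPow_one] using qPochTail_sub_one hq (m + 1)
  have two : qPow lq 2 = exp lq ^ 2 := mod_cast qPow_natCast lq 2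
  rw [qPochTail_sub_one hq a, qPochTail_sub_one hq b, raise a, raise b]
  simp only [qPow_add, qPow_one, two]
  ring

/-- Multiplying the `n`-th finite triple product by the new factors
`(1 - x q^n) (1 - x⁻¹ q^{n+1})` produces a three-term recurrence for its coefficients. -/
theorem qPochTail_mul_thetaTerm_recurrence (hq : ‖exp lq‖ < 1) (z : ℂ) (n j : ℤ) :
    (1 + qPow lq (2 * n + 1)) *
            (qPochTail lq (n + j) * qPochTail lq (n - j) * thetaTerm lq z j) +
          -(qPow lq n * qPow lq z) *
            (qPochTail lq (n + (j - 1)) * qPochTail lq (n - (j - 1)) * thetaTerm lq z (j - 1)) +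
        -(qPow lq (n + 1) * qPow lq (-z)) *
          (qPochTail lq (n + (j + 1)) * qPochTail lq (n - (j + 1)) * thetaTerm lq z (j + 1)) =
      (1 - qPow lq (2 * n + 1)) * (1 - qPow lq (2 * n + 2)) *
        (qPochTail lq (n + 1 + j) * qPochTail lq (n + 1 - j) * thetaTerm lq z j) := by
  have recurrence := qPochTail_mul_qPochTail_recurrence hq (n + j) (n - j)
  have exponent : ((n + j : ℤ) : ℂ) + ((n - j : ℤ) : ℂ) = 2 * n := by push_cast; ring
  have below := qPow_mul_thetaTerm_sub_one lq z j
  have above := qPow_neg_mul_thetaTerm_add_one lq z j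
  rw [exponent, show n + j - 1 = n + (j - 1) by ring, show n - j + 1 = n - (j - 1) by ring,
    show n + j + 1 = n + (j + 1) by ring, show n - j - 1 = n - (j + 1) by ring,
    show ((n - j : ℤ) : ℂ) + 1 = n + (1 - j) by push_cast; ring,
    show ((n + j : ℤ) : ℂ) + 1 = (n + 1) + j by push_cast; ring,
    qPow_add lq n (1 - j), qPow_add lq (n + 1) j] at recurrence
  rw [show n + 1 + j = n + (j + 1) by ring, show n + 1 - j = n - (j - 1) by ring]
  linear_combination thetaTerm lq z j * recurrence -
    qPow lq n * qPochTail lq (n + (j - 1)) * qPochTail lq (n - (j - 1)) * below -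
    qPow lq (n + 1) * qPochTail lq (n + (j + 1)) * qPochTail lq (n - (j + 1)) * above

theorem qPochTail_two_mul (hq : ‖exp lq‖ < 1) (n : ℤ) :
    qPochTail lq (2 * n) =
      (1 - qPow lq (2 * n + 1)) * (1 - qPow lq (2 * n + 2)) * qPochTail lq (2 * (n + 1)) := by
  have raise₁ := qPochTail_sub_one hq (2 * n + 1)
  have raise₂ := qPochTail_sub_one hq (2 * n + 2)
  push_cast at raise₁ raise₂
  rw [show 2 * n + 2 - 1 = 2 * n + 1 by ring] at raise₂
  rw [mul_assoc, mul_add, mul_one, ← raise₂, ← raise₁, add_sub_cancel_right]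

theorem one_sub_qPow_mul_one_sub_qPow (lq z n : ℂ) :
    (1 - qPow lq z * qPow lq n) * (1 - qPow lq (1 - z) * qPow lq n) =
      1 + qPow lq (2 * n + 1) - qPow lq n * qPow lq z - qPow lq (n + 1) * qPow lq (-z) := by
  have inv : qPow lq z * qPow lq (-z) = 1 := by rw [← qPow_add, add_neg_cancel, qPow_zero]
  simp only [two_mul, sub_eq_add_neg, qPow_add, qPow_one]
  linear_combination qPow lq n ^ 2 * exp lq * inv

theorem hasSum_finite_triple_product (hq : ‖exp lq‖ < 1) (z : ℂ) (n : ℕ) :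
    HasSum (fun j : ℤ => qPochTail lq (n + j) * qPochTail lq (n - j) * thetaTerm lq z j)
      (qPochTail lq 0 * qPochTail lq (2 * n) *
        ((∏ k ∈ Finset.range n, (1 - qPow lq z * exp lq ^ k)) *
          ∏ k ∈ Finset.range n, (1 - qPow lq (1 - z) * exp lq ^ k))) := by
  induction n with
  | zero =>
    have vanish (j : ℤ) (hj : j ≠ 0) : qPochTail lq j * qPochTail lq (-j) = 0 := by
      rcases hj.lt_or_gt with h | h
      · rw [qPochTail_eq_zero hq h, zero_mul]
      · rw [qPochTail_eq_zero hq (neg_lt_zero.mpr h), mul_zero]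
    convert hasSum_single (α := ℂ) (0 : ℤ) fun j hj => ?_ using 1
    · simp [thetaTerm, qPow_zero]
    · simp [vanish j hj]
  | succ n ih =>
    have center := ih.mul_left (1 + qPow lq (2 * n + 1))
    have below := ((Equiv.subRight (1 : ℤ)).hasSum_iff.mpr ih).mul_left
      (-(qPow lq n * qPow lq z))
    have above := ((Equiv.addRight (1 : ℤ)).hasSum_iff.mpr ih).mul_left
      (-(qPow lq (n + 1) * qPow lq (-z)))
    have h₁ : qPow lq (2 * n + 1) ≠ 1 := mod_cast qPow_natCast_ne_one hq (2 * n).succ_ne_zero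
    have h₂ : qPow lq (2 * n + 2) ≠ 1 := mod_cast qPow_natCast_ne_one hq (2 * n + 1).succ_ne_zero
    have tail := qPochTail_two_mul hq n
    have factors := one_sub_qPow_mul_one_sub_qPow lq z n
    have coeff (j : ℤ) := qPochTail_mul_thetaTerm_recurrence hq z n j
    simp only [Int.cast_natCast, qPow_natCast lq n] at tail factors coeff
    rw [← hasSum_mul_left_iff (mul_ne_zero (sub_ne_zero.mpr h₁.symm) (sub_ne_zero.mpr h₂.symm))]
    refine Eq.mp ?_ ((center.add below).add above)
    congr 1
    · funext j
      simp only [Function.comp_apply, Equiv.subRight_apply, Equiv.coe_addRight, qPow_natCast lq n,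
        coeff, Nat.cast_add, Nat.cast_one]
    · rw [Finset.prod_range_succ, Finset.prod_range_succ, tail, qPow_natCast]
      push_cast
      linear_combination (-(1 - qPow lq (2 * n + 1)) * (1 - qPow lq (2 * n + 2)) *
        qPochTail lq 0 * qPochTail lq (2 * (n + 1)) *
        (∏ k ∈ Finset.range n, (1 - qPow lq z * exp lq ^ k)) *
        (∏ k ∈ Finset.range n, (1 - qPow lq (1 - z) * exp lq ^ k))) * factors

theorem re_lt_zero_of_norm_exp_lt_one (hq : ‖exp lq‖ < 1) : lq.re < 0 := by
  rwa [norm_exp, Real.exp_lt_one_iff] at hq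

theorem summable_exp_quadratic {a : ℂ} (ha : a.re < 0) (b : ℂ) :
    Summable fun j : ℤ => exp (a * j ^ 2 + b * j) := by
  have hpi : (Real.pi : ℂ) ≠ 0 := mod_cast Real.pi_ne_zero
  have him : 0 < (a / (Real.pi * I)).im := by
    rw [div_mul_eq_div_div, div_I, neg_im, mul_I_im, div_ofReal_re]
    exact neg_pos.mpr (div_neg_of_neg_of_pos ha Real.pi_pos)
  refine ((summable_jacobiTheta₂_term_iff (b / (2 * Real.pi * I)) _).mpr him).congr fun j => ?_
  rw [jacobiTheta₂_term]
  congr 1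
  field_simp
  ring

theorem summable_thetaTerm (hq : ‖exp lq‖ < 1) (z : ℂ) : Summable (thetaTerm lq z) := by
  have ha : (lq / 2).re < 0 := by
    rw [div_ofNat_re]
    exact div_neg_of_neg_of_pos (re_lt_zero_of_norm_exp_lt_one hq) two_pos
  have gaussian := summable_exp_quadratic ha (lq * z - lq / 2)
  refine Summable.of_norm (gaussian.norm.congr fun j => ?_)
  rw [thetaTerm, norm_mul, norm_zpow, norm_neg, norm_one, one_zpow, one_mul, qPow]
  congr 2
  ring

theorem qTheta_qPow (lq z : ℂ) :
    qTheta (exp lq) (qPow lq z) =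
      qPoch (exp lq) (qPow lq z) * qPoch (exp lq) (qPow lq (1 - z)) := by
  rw [qTheta, qPow_sub, qPow_one]

theorem jacobi_triple_product (hq : ‖exp lq‖ < 1) (z : ℂ) :
    qPoch (exp lq) (exp lq) * qTheta (exp lq) (qPow lq z) = ∑' j : ℤ, thetaTerm lq z j := by
  obtain ⟨K, hK⟩ := exists_norm_qPochTail_le hq
  have tail_limit := tendsto_qPochTail hq
  have shift (j : ℤ) : Tendsto (fun n : ℕ => (n : ℤ) + j) atTop atTop :=
    tendsto_atTop_add_const_right _ _ tendsto_natCast_atTop_atTop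
  have double : Tendsto (fun n : ℕ => 2 * (n : ℤ)) atTop atTop :=
    tendsto_natCast_atTop_atTop.const_mul_atTop' two_pos
  have products := ((tail_limit.comp double).const_mul (qPochTail lq 0)).mul
    ((tendsto_prod_range_qPoch hq (qPow lq z)).mul (tendsto_prod_range_qPoch hq (qPow lq (1 - z))))
  have sums := tendsto_tsum_of_dominated_convergence (𝓕 := atTop)
    (f := fun (n : ℕ) (j : ℤ) => qPochTail lq (n + j) * qPochTail lq (n - j) * thetaTerm lq z j)
    ((summable_thetaTerm hq z).norm.mul_left (K * K))
    (fun j => ((tail_limit.comp (shift j)).mul (tail_limit.comp (shift (-j)))).mul_const _)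
    (.of_forall fun n j => by
      simp only [norm_mul]
      gcongr
      exacts [(norm_nonneg _).trans (hK 0), hK _, hK _])
  simp only [(hasSum_finite_triple_product hq z _).tsum_eq, mul_one, one_mul] at sums
  have limits := tendsto_nhds_unique products sums
  rwa [mul_one, qPochTail_zero, ← qTheta_qPow] at limits

end TripleProduct

section AdditionFormula

variable {lq : ℂ}

/-- Pairs of integers with even sum are the pairs `(m + n, m - n)`, those with odd sum the pairs
`(m + n, m - n + 1)`. -/
def intPairParityEquiv : (ℤ × ℤ) ⊕ (ℤ × ℤ) ≃ ℤ × ℤ where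
  toFun := Sum.elim (fun p => (p.1 + p.2, p.1 - p.2)) (fun p => (p.1 + p.2, p.1 - p.2 + 1))
  invFun p := if (p.1 + p.2) % 2 = 0 then Sum.inl ((p.1 + p.2) / 2, (p.1 - p.2) / 2)
    else Sum.inr ((p.1 + p.2) / 2, (p.1 - p.2 + 1) / 2)
  left_inv := by
    rintro (⟨m, n⟩ | ⟨m, n⟩)
    · have even : (m + n + (m - n)) % 2 = 0 := by omega
      simp only [Sum.elim_inl, even, if_true, Sum.inl.injEq, Prod.mk.injEq]
      omega
    · have odd : (m + n + (m - n + 1)) % 2 ≠ 0 := by omega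
      simp only [Sum.elim_inr, odd, if_false, Sum.inr.injEq, Prod.mk.injEq]
      omega
  right_inv := by
    rintro ⟨j, k⟩
    by_cases even : (j + k) % 2 = 0
    · simp only [if_pos even, Sum.elim_inl, Prod.mk.injEq]
      omega
    · simp only [if_neg even, Sum.elim_inr, Prod.mk.injEq]
      omega

/-- The theta series `∑ q^{n²} x^{2n}` at `x = q^z`, where `q = exp lq`. -/
noncomputable def thetaEven (lq z : ℂ) : ℂ := ∑' n : ℤ, qPow lq (n ^ 2 + 2 * n * z)

/-- The theta series `∑ q^{n² - n} x^{2n - 1}` at `x = q^z`, where `q = exp lq`. -/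
noncomputable def thetaOdd (lq z : ℂ) : ℂ := ∑' n : ℤ, qPow lq (n ^ 2 - n + (2 * n - 1) * z)

theorem summable_thetaEven (hq : ‖exp lq‖ < 1) (z : ℂ) :
    Summable fun n : ℤ => qPow lq (n ^ 2 + 2 * n * z) := by
  refine (summable_exp_quadratic (re_lt_zero_of_norm_exp_lt_one hq) (lq * (2 * z))).congr
    fun n => ?_
  rw [qPow]
  ring_nf

theorem summable_thetaOdd (hq : ‖exp lq‖ < 1) (z : ℂ) :
    Summable fun n : ℤ => qPow lq (n ^ 2 - n + (2 * n - 1) * z) := by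
  refine ((summable_exp_quadratic (re_lt_zero_of_norm_exp_lt_one hq)
    (lq * (2 * z - 1))).mul_left (qPow lq (-z))).congr fun n => ?_
  rw [qPow, qPow, ← exp_add]
  ring_nf

theorem hasSum_mul_of_summable {f g : ℤ → ℂ} (hf : Summable f) (hg : Summable g) :
    HasSum (fun p : ℤ × ℤ => f p.1 * g p.2) ((∑' j, f j) * ∑' j, g j) :=
  hf.hasSum.mul hg.hasSum (summable_mul_of_summable_norm hf.norm hg.norm)

theorem thetaTerm_mul_thetaTerm_of_even_sum (lq x y : ℂ) (m n : ℤ) :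
    thetaTerm lq (x + y) (m + n) * thetaTerm lq (x - y) (m - n) =
      qPow lq x *
        (qPow lq (m ^ 2 - m + (2 * m - 1) * x) * qPow lq (n ^ 2 + 2 * n * y)) := by
  have sign : (-1 : ℂ) ^ (m + n) * (-1) ^ (m - n) = 1 := by
    rw [← zpow_add₀ (by norm_num)]
    exact Even.neg_one_zpow ⟨m, by ring⟩
  rw [thetaTerm, thetaTerm, mul_mul_mul_comm, sign, one_mul]
  simp only [← qPow_add]
  congr 1
  push_cast
  ring

theorem thetaTerm_mul_thetaTerm_of_odd_sum (lq x y : ℂ) (m n : ℤ) :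
    thetaTerm lq (x + y) (m + n) * thetaTerm lq (x - y) (m - n + 1) =
      -qPow lq x *
        (qPow lq (m ^ 2 + 2 * m * x) * qPow lq (n ^ 2 - n + (2 * n - 1) * y)) := by
  have sign : (-1 : ℂ) ^ (m + n) * (-1) ^ (m - n + 1) = -1 := by
    rw [← zpow_add₀ (by norm_num)]
    exact Odd.neg_one_zpow ⟨m, by ring⟩
  rw [thetaTerm, thetaTerm, mul_mul_mul_comm, sign, neg_mul, neg_mul, one_mul]
  simp only [← qPow_add]
  congr 2
  push_cast
  ring

theorem tsum_thetaTerm_mul_tsum_thetaTerm (hq : ‖exp lq‖ < 1) (x y : ℂ) :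
    (∑' j : ℤ, thetaTerm lq (x + y) j) * ∑' j : ℤ, thetaTerm lq (x - y) j =
      qPow lq x * (thetaOdd lq x * thetaEven lq y - thetaEven lq x * thetaOdd lq y) := by
  have all := hasSum_mul_of_summable (summable_thetaTerm hq (x + y)) (summable_thetaTerm hq (x - y))
  have even := (hasSum_mul_of_summable (summable_thetaOdd hq x)
    (summable_thetaEven hq y)).mul_left (qPow lq x)
  have odd := (hasSum_mul_of_summable (summable_thetaEven hq x)
    (summable_thetaOdd hq y)).mul_left (-qPow lq x)
  simp only [← thetaTerm_mul_thetaTerm_of_even_sum] at even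
  simp only [← thetaTerm_mul_thetaTerm_of_odd_sum] at odd
  rw [(intPairParityEquiv.hasSum_iff.mpr all).unique (HasSum.sum even odd)]
  simp only [thetaOdd, thetaEven]
  ring

/-- The left half `x^{-1/2} (x)_∞` of `sigmaTheta` at `x = q^z`, where `q = exp lq`. -/
noncomputable def sigmaLeft (lq z : ℂ) : ℂ := qPow lq (-z / 2) * qPoch (exp lq) (qPow lq z)

/-- The right half `(q/x)_∞` of `sigmaTheta` at `x = q^z`, where `q = exp lq`. -/
noncomputable def sigmaRight (lq z : ℂ) : ℂ := qPoch (exp lq) (qPow lq (1 - z))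

/-- The theta function `x^{-1/2} θ(x)` at `x = q^z`, where `q = exp lq`: the power of `x` makes it
odd in `z`. -/
noncomputable def sigmaTheta (lq z : ℂ) : ℂ := sigmaLeft lq z * sigmaRight lq z

theorem qTheta_qPow_eq_mul_sigmaTheta (lq z : ℂ) :
    qTheta (exp lq) (qPow lq z) = qPow lq (z / 2) * sigmaTheta lq z := by
  have inv : qPow lq (z / 2) * qPow lq (-z / 2) = 1 := by
    rw [← qPow_add, neg_div, add_neg_cancel, qPow_zero]
  rw [qTheta_qPow, sigmaTheta, sigmaLeft, sigmaRight]
  linear_combination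
    -(qPoch (exp lq) (qPow lq z) * qPoch (exp lq) (qPow lq (1 - z))) * inv

theorem sigmaTheta_neg (hq : ‖exp lq‖ < 1) (z : ℂ) : sigmaTheta lq (-z) = -sigmaTheta lq z := by
  have raise (w : ℂ) : qPoch (exp lq) (qPow lq w) =
      (1 - qPow lq w) * qPoch (exp lq) (qPow lq (1 + w)) := by
    rw [← one_sub_mul_qPoch hq, add_comm, qPow_add, qPow_one]
  have power : qPow lq (z / 2) = qPow lq (-z / 2) * qPow lq z := by
    rw [← qPow_add]
    ring_nf
  have inv : qPow lq z * qPow lq (-z) = 1 := by rw [← qPow_add, add_neg_cancel, qPow_zero]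
  simp only [sigmaTheta, sigmaLeft, sigmaRight, sub_eq_add_neg, neg_neg, raise z, raise (-z), power]
  linear_combination (-qPow lq (-z / 2) * qPoch (exp lq) (qPow lq (1 + -z)) *
    qPoch (exp lq) (qPow lq (1 + z))) * inv

theorem sigmaTheta_ne_zero (hq : ‖exp lq‖ < 1) {z : ℂ} (hz : ∀ n : ℤ, qPow lq z ≠ exp lq ^ n) :
    sigmaTheta lq z ≠ 0 := by
  simp only [sigmaTheta, sigmaLeft, sigmaRight]
  refine mul_ne_zero (mul_ne_zero (qPow_ne_zero _ _) ?_) ?_ <;>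
    rw [Ne, qPoch_eq_zero_iff hq] <;> rintro ⟨k, hk⟩ <;> rw [← qPow_natCast] at hk
  · apply hz (-k)
    rw [← qPow_intCast, eq_comm]
    push_cast
    rw [qPow_neg, inv_eq_of_mul_eq_one_left hk]
  · apply hz (1 + k)
    rw [← qPow_intCast, ← mul_one (qPow lq z), ← hk, ← qPow_add, ← qPow_add]
    push_cast
    ring_nf

theorem exists_sigmaTheta_add_mul_sigmaTheta_sub (hq : ‖exp lq‖ < 1) : ∃ f g : ℂ → ℂ, ∀ x y,
    sigmaTheta lq (x + y) * sigmaTheta lq (x - y) = f x * g y - g x * f y := by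
  have h₀ := qPochTail_zero_ne_zero hq
  rw [qPochTail_zero] at h₀
  refine ⟨fun x => thetaOdd lq x / qPoch (exp lq) (exp lq),
    fun x => thetaEven lq x / qPoch (exp lq) (exp lq), fun x y => ?_⟩
  have product := tsum_thetaTerm_mul_tsum_thetaTerm hq x y
  have power : qPow lq ((x + y) / 2) * qPow lq ((x - y) / 2) = qPow lq x := by
    rw [← qPow_add]
    ring_nf
  simp only [← jacobi_triple_product hq, qTheta_qPow_eq_mul_sigmaTheta, ← power] at product
  have := qPow_ne_zero lq ((x + y) / 2)
  have := qPow_ne_zero lq ((x - y) / 2)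
  field_simp at product ⊢
  linear_combination product

theorem sigmaTheta_three_term (hq : ‖exp lq‖ < 1) (x y z t : ℂ) :
    sigmaTheta lq (x + y + t) * sigmaTheta lq (x - y) * sigmaTheta lq (z + t) * sigmaTheta lq z +
      sigmaTheta lq (y + z + t) * sigmaTheta lq (y - z) * sigmaTheta lq (x + t) * sigmaTheta lq x +
      sigmaTheta lq (z + x + t) * sigmaTheta lq (z - x) * sigmaTheta lq (y + t) * sigmaTheta lq y =
      0 := by
  obtain ⟨f, g, det⟩ := exists_sigmaTheta_add_mul_sigmaTheta_sub hq
  have pair (a b : ℂ) : sigmaTheta lq (a + b + t) * sigmaTheta lq (a - b) =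
      f (a + t / 2) * g (b + t / 2) - g (a + t / 2) * f (b + t / 2) := by
    rw [← det]
    ring_nf
  have single (a : ℂ) : sigmaTheta lq (a + t) * sigmaTheta lq a =
      f (a + t / 2) * g (t / 2) - g (a + t / 2) * f (t / 2) := by
    rw [← det]
    ring_nf
  simp only [mul_assoc _ _ (sigmaTheta lq _), single, pair]
  ring

end AdditionFormula

/-- An odd function `sigma` satisfying Weierstrass's three-term identity, together with a
factorization `left * right` of it. The identity is the usual one in the variables
`x + t / 2`, `y + t / 2`, `z + t / 2`, written so that it makes sense in any abelian group. -/
structure FactoredSigma (G K : Type*) [AddCommGroup G] [Field K] where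
  sigma : G → K
  left : G → K
  right : G → K
  left_mul_right : ∀ z, left z * right z = sigma z
  sigma_neg : ∀ z, sigma (-z) = -sigma z
  three_term : ∀ x y z t,
    sigma (x + y + t) * sigma (x - y) * sigma (z + t) * sigma z +
      sigma (y + z + t) * sigma (y - z) * sigma (x + t) * sigma x +
      sigma (z + x + t) * sigma (z - x) * sigma (y + t) * sigma y = 0

namespace FactoredSigma

variable {G K : Type*} [AddCommGroup G] [Field K] (S : FactoredSigma G K)

/-- The same function with the roles of the two factors exchanged. -/
@[simps]
def swap : FactoredSigma G K where
  sigma := S.sigma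
  left := S.right
  right := S.left
  left_mul_right z := by rw [mul_comm, S.left_mul_right]
  sigma_neg := S.sigma_neg
  three_term := S.three_term

/-- The entry at the upper left of the `2 × 2` block with parameters `b₀`, `b₁`. In the paper's
notation `e` is the exponent of `q b_r ⋯ b_M / c`, and `χ` collects the powers of the spectral
variable `x`. -/
def topLeft (b₀ b₁ e : G) (χ : AddChar G K) (x : G) : K :=
  S.left b₀ * S.right b₁ / (S.left (b₀ - e) * S.right (b₁ - e)) *
    (S.sigma (x + b₀ - e) / S.sigma (x + b₀)) * χ (-e)

/-- The entry at the upper right of the `2 × 2` block. -/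
def topRight (b₀ b₁ e : G) (χ : AddChar G K) (x : G) : K :=
  S.left e * S.right (b₀ + b₁ - e) / (S.left (e - b₀) * S.right (b₁ - e)) *
    (S.sigma x / S.sigma (x + b₀)) * χ (-b₀)

/-- The entry at the lower left of the `2 × 2` block. -/
def bottomLeft (b₀ b₁ e : G) (χ : AddChar G K) (x : G) : K :=
  S.left (b₀ + b₁ - e) * S.right e / (S.left (b₀ - e) * S.right (e - b₁)) *
    (S.sigma (x + b₀ - b₁) / S.sigma (x + b₀)) * χ (-b₁)

/-- The entry at the lower right of the `2 × 2` block. -/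
def bottomRight (b₀ b₁ e : G) (χ : AddChar G K) (x : G) : K :=
  S.left b₁ * S.right b₀ / (S.left (e - b₀) * S.right (e - b₁)) *
    (S.sigma (x + e - b₁) / S.sigma (x + b₀)) * χ (e - b₀ - b₁)

variable {S} {A B C e x y : G} {χ ψ : AddChar G K}

theorem left_ne_zero {z : G} (h : S.sigma z ≠ 0) : S.left z ≠ 0 :=
  left_ne_zero_of_mul ((S.left_mul_right z).trans_ne h)

theorem right_ne_zero {z : G} (h : S.sigma z ≠ 0) : S.right z ≠ 0 :=
  right_ne_zero_of_mul ((S.left_mul_right z).trans_ne h)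

theorem sigma_sub_comm (z w : G) : S.sigma (z - w) = -S.sigma (w - z) := by
  rw [← neg_sub, S.sigma_neg]

theorem sigma_sub_ne_zero_comm {z w : G} : S.sigma (z - w) ≠ 0 ↔ S.sigma (w - z) ≠ 0 := by
  rw [sigma_sub_comm, neg_ne_zero]

theorem left_sub_eq {z w : G} (h : S.sigma (w - z) ≠ 0) :
    S.left (z - w) = -(S.left (w - z) * S.right (w - z)) / S.right (z - w) := by
  rw [eq_div_iff (right_ne_zero (sigma_sub_ne_zero_comm.mp h)), S.left_mul_right,
    S.left_mul_right, sigma_sub_comm]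

theorem character_ne_zero (χ : AddChar G K) (z : G) : χ z ≠ 0 :=
  (χ.val_isUnit z).ne_zero

theorem yangBaxter_entry_zero_zero
    (hxB : S.sigma (x + B) ≠ 0) (hyA : S.sigma (y + A) ≠ 0) (hxyA : S.sigma (x + y + A) ≠ 0)
    (hB : S.sigma (B - e) ≠ 0) (hAB : S.sigma (A + B - e) ≠ 0) (hBC : S.sigma (B + C - e) ≠ 0) :
    S.topLeft B C e χ x * S.topLeft A B e ψ y +
        S.topRight B C e χ x * S.topLeft A C (e - B) (χ * ψ) (x + y) * S.bottomLeft A B e ψ y =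
      S.topLeft A C e (χ * ψ) (x + y) := by
  have weierstrass : S.sigma B * S.sigma (x + B - e) * S.sigma (y + A - e) * S.sigma (x + y + A) +
      S.sigma (y + A) * -S.sigma (x + y + A - e) * S.sigma (B - e) * S.sigma (x + B) +
      S.sigma (x + y + A + B - e) * S.sigma (y + A - B) * -S.sigma x * S.sigma e = 0 := by
    simp only [← S.sigma_neg]
    convert S.three_term (x + B) e (x + y + A) (-e - x) using 5 <;> abel_nf
  rw [← S.left_mul_right B, ← S.left_mul_right e, ← S.left_mul_right (B - e)] at weierstrass
  simp only [topLeft, topRight, bottomLeft, AddChar.mul_apply, sub_sub_eq_add_sub, add_comm C B,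
    left_sub_eq hB, AddChar.map_sub_eq_div, AddChar.map_neg_eq_inv]
  have := left_ne_zero hB; have := left_ne_zero hAB
  have := right_ne_zero hB; have := right_ne_zero (sigma_sub_ne_zero_comm.mp hB)
  have := right_ne_zero hBC
  have := character_ne_zero χ B; have := character_ne_zero ψ B
  linear_combination (norm := (field_simp; ring))
    (S.left A * S.right C / (S.left (A - e) * S.right (C - e) * S.left (B - e) * S.right (B - e) *
      S.sigma (x + B) * S.sigma (y + A) * S.sigma (x + y + A) * χ e * ψ e)) * weierstrass

theorem yangBaxter_entry_zero_one
    (hyA : S.sigma (y + A) ≠ 0) (hxyA : S.sigma (x + y + A) ≠ 0) (hB : S.sigma (B - e) ≠ 0)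
    (hAB : S.sigma (A + B - e) ≠ 0) (hAC : S.sigma (A + C - e) ≠ 0)
    (hBC : S.sigma (B + C - e) ≠ 0) :
    S.topLeft B C e χ x * S.topRight A B e ψ y +
        S.topRight B C e χ x * S.topLeft A C (e - B) (χ * ψ) (x + y) * S.bottomRight A B e ψ y =
      S.topRight A C e (χ * ψ) (x + y) * S.topLeft B C (e - A) χ x := by
  have weierstrass : S.sigma (x + B - e) * S.sigma y * S.sigma (x + y + A) * S.sigma (A + B - e) +
      S.sigma (x + B + A - e) * -S.sigma (y + A) * S.sigma (x + y) * S.sigma (B - e) +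
      S.sigma (x + y + A + B - e) * S.sigma A * S.sigma x * -S.sigma (y + e - B) = 0 := by
    simp only [← S.sigma_neg]
    convert S.three_term (B - e) (B - e - y) (A + B - e) (x + y + e - B) using 5 <;> abel_nf
  rw [← S.left_mul_right A, ← S.left_mul_right (B - e), ← S.left_mul_right (A + B - e)]
    at weierstrass
  simp only [topLeft, topRight, bottomRight, AddChar.mul_apply, sub_sub_eq_add_sub, add_comm C B,
    add_comm B A, add_comm C A, left_sub_eq hB, AddChar.map_sub_eq_div, AddChar.map_neg_eq_inv]
  have := left_ne_zero hB; have := left_ne_zero hAB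
  have := right_ne_zero hB; have := right_ne_zero (sigma_sub_ne_zero_comm.mp hB)
  have := right_ne_zero hAC; have := right_ne_zero hBC
  have := character_ne_zero χ A
  have := character_ne_zero χ B; have := character_ne_zero ψ B
  have := character_ne_zero ψ e
  linear_combination (norm := (field_simp; ring))
    (S.left B * S.right C * S.left e / (S.left (e - A) * S.right (C - e) * S.left (A + B - e) *
      S.left (B - e) * S.right (B - e) * S.sigma (x + B) * S.sigma (y + A) * S.sigma (x + y + A) *
      χ e * ψ A)) * weierstrass

theorem yangBaxter_entry_zero_two
    (hA : S.sigma (A - e) ≠ 0) (hB : S.sigma (B - e) ≠ 0)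
    (hAC : S.sigma (A + C - e) ≠ 0) (hBC : S.sigma (B + C - e) ≠ 0) :
    S.topRight B C e χ x * S.topRight A C (e - B) (χ * ψ) (x + y) =
      S.topRight A C e (χ * ψ) (x + y) * S.topRight B C (e - A) χ x := by
  have := left_ne_zero (sigma_sub_ne_zero_comm.mp hA)
  have := left_ne_zero (sigma_sub_ne_zero_comm.mp hB)
  have := right_ne_zero hAC; have := right_ne_zero hBC
  have prefactor_eq :
      S.left e * S.right (B + C - e) / (S.left (e - B) * S.right (C - e)) *
        (S.left (e - B) * S.right (A + B + C - e) / (S.left (e - A - B) * S.right (B + C - e))) =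
      S.left e * S.right (A + C - e) / (S.left (e - A) * S.right (C - e)) *
        (S.left (e - A) * S.right (A + B + C - e) /
          (S.left (e - A - B) * S.right (A + C - e))) := by
    field_simp
  simp only [topRight, sub_sub_eq_add_sub, add_comm C B, add_comm C A, add_right_comm A C B,
    add_comm (B + C) A, ← add_assoc, sub_right_comm e B A]
  linear_combination S.sigma x / S.sigma (x + B) * (S.sigma (x + y) / S.sigma (x + y + A)) *
    χ (-B) * (χ * ψ) (-A) * prefactor_eq

theorem yangBaxter_entry_one_zero
    (hxB : S.sigma (x + B) ≠ 0) (hxyA : S.sigma (x + y + A) ≠ 0) (hB : S.sigma (B - e) ≠ 0)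
    (hAB : S.sigma (A + B - e) ≠ 0) (hAC : S.sigma (A + C - e) ≠ 0)
    (hBC : S.sigma (B + C - e) ≠ 0) :
    S.bottomLeft B C e χ x * S.topLeft A B e ψ y +
        S.bottomRight B C e χ x * S.topLeft A C (e - B) (χ * ψ) (x + y) * S.bottomLeft A B e ψ y =
      S.topLeft A B (e - C) ψ y * S.bottomLeft A C e (χ * ψ) (x + y) := by
  have weierstrass :
      S.sigma (B + C - e) * S.sigma (x + B - C) * S.sigma (y + A - e) * S.sigma (x + y + A) +
      S.sigma (y + A + C - e) * -S.sigma (x + y + A - C) * S.sigma (B - e) * S.sigma (x + B) +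
      S.sigma (x + y + A + B - e) * S.sigma (y + A - B) * -S.sigma (x + e - C) * S.sigma C =
        0 := by
    simp only [← S.sigma_neg]
    convert S.three_term (x + B) C (x + y + A) (-e - x) using 5 <;> abel_nf
  rw [← S.left_mul_right C, ← S.left_mul_right (B - e), ← S.left_mul_right (B + C - e)]
    at weierstrass
  simp only [topLeft, bottomLeft, bottomRight, AddChar.mul_apply, sub_sub_eq_add_sub, add_comm C B,
    left_sub_eq hB, AddChar.map_sub_eq_div, AddChar.map_neg_eq_inv]
  have := left_ne_zero hB; have := left_ne_zero hAB
  have := left_ne_zero hAC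
  have := right_ne_zero hB; have := right_ne_zero (sigma_sub_ne_zero_comm.mp hB)
  have := right_ne_zero hBC
  have := character_ne_zero χ B; have := character_ne_zero ψ B
  have := character_ne_zero ψ C
  have := character_ne_zero χ e
  linear_combination (norm := (field_simp; ring))
    (S.left A * S.right B * S.right e / (S.left (A - e) * S.right (e - C) * S.right (B + C - e) *
      S.left (B - e) * S.right (B - e) * S.sigma (x + B) * S.sigma (y + A) * S.sigma (x + y + A) *
      χ C * ψ e)) * weierstrass

theorem sigma_four_term (A B C e x y : G) :
    S.sigma (A + B - e) * S.sigma (A + C - e) * S.sigma (B + C - e) * S.sigma e *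
        (S.sigma (x + B - C) * S.sigma y * S.sigma (x + y + A)) +
      S.sigma (A + B + C - e) * S.sigma (A - e) * S.sigma (B - e) * S.sigma (C - e) *
        (S.sigma (x + B - C) * S.sigma y * S.sigma (x + y + A)) =
    S.sigma A * S.sigma B * S.sigma C *
      (S.sigma (x + e - C) * S.sigma (x + y + A + B - e) * S.sigma (y + e - B) *
          S.sigma (A + C - e) +
        S.sigma (x + y + e - C) * S.sigma (x + B + A - e) * S.sigma (y + A + C - e) *
          S.sigma (B - e)) := by
  have h : -S.sigma e * S.sigma (B + C - e) * S.sigma (A + C - e) * S.sigma (A + B - e) +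
      S.sigma (A - e) * -S.sigma (A + B + C - e) * S.sigma (C - e) * S.sigma (B - e) +
      S.sigma (A + B + C - e - e) * S.sigma A * -S.sigma B * -S.sigma C = 0 := by
    simp only [← S.sigma_neg]
    convert S.three_term (B - e) (-C) (A + B - e) (C - B) using 5 <;> abel_nf
  have h' : -S.sigma (x + e - C) * S.sigma (x + y + A + B - e) * -S.sigma (y + e - B) *
        S.sigma (A + C - e) +
      -S.sigma (x + y + e - C) * -S.sigma (x + B + A - e) * S.sigma (B - e) *
        S.sigma (y + A + C - e) +
      S.sigma (A + B + C - e - e) * -S.sigma y * -S.sigma (x + y + A) * -S.sigma (x + B - C) =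
        0 := by
    simp only [← S.sigma_neg]
    convert S.three_term (y + A + C - e) (C - B - x) (A + C - e) (B - A - C - y) using 5 <;> abel_nf
  -- Both identities contain `σ (A + B + C - 2e)`, which is eliminated here.
  linear_combination -(S.sigma (x + B - C) * S.sigma y * S.sigma (x + y + A)) * h -
    S.sigma A * S.sigma B * S.sigma C * h'

theorem yangBaxter_entry_one_one
    (hxyA : S.sigma (x + y + A) ≠ 0) (hA : S.sigma (A - e) ≠ 0) (hB : S.sigma (B - e) ≠ 0)
    (hC : S.sigma (C - e) ≠ 0) (hAB : S.sigma (A + B - e) ≠ 0)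
    (hAC : S.sigma (A + C - e) ≠ 0) (hBC : S.sigma (B + C - e) ≠ 0) :
    S.bottomLeft B C e χ x * S.topRight A B e ψ y +
        S.bottomRight B C e χ x * S.topLeft A C (e - B) (χ * ψ) (x + y) *
          S.bottomRight A B e ψ y =
      S.topLeft A B (e - C) ψ y * S.bottomRight A C e (χ * ψ) (x + y) *
          S.topLeft B C (e - A) χ x +
        S.topRight A B (e - C) ψ y * S.bottomLeft B C (e - A) χ x := by
  have weierstrass := S.sigma_four_term A B C e x y
  rw [sigma_sub_comm A e, sigma_sub_comm C e] at weierstrass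
  simp only [← S.left_mul_right A, ← S.left_mul_right B, ← S.left_mul_right C,
    ← S.left_mul_right e, ← S.left_mul_right (B - e), ← S.left_mul_right (e - A),
    ← S.left_mul_right (e - C), ← S.left_mul_right (A + B - e), ← S.left_mul_right (A + C - e),
    ← S.left_mul_right (B + C - e), ← S.left_mul_right (A + B + C - e)] at weierstrass
  have hAC' := sigma_sub_ne_zero_comm.mp hAC
  simp only [topLeft, topRight, bottomLeft, bottomRight, AddChar.mul_apply, sub_sub_eq_add_sub,
    add_comm C B, add_comm B A, add_comm C A, add_comm (B + C) A, ← add_assoc, sub_right_comm e C A,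
    sub_sub e A C, left_sub_eq hB, left_sub_eq hAC, AddChar.map_sub_eq_div,
    AddChar.map_neg_eq_inv, AddChar.map_add_eq_mul]
  have := left_ne_zero (sigma_sub_ne_zero_comm.mp hA)
  have := left_ne_zero hB; have := left_ne_zero hAB; have := left_ne_zero hAC
  have := right_ne_zero hB; have := right_ne_zero (sigma_sub_ne_zero_comm.mp hB)
  have := right_ne_zero hAC; have := right_ne_zero hAC'
  have := right_ne_zero (sigma_sub_ne_zero_comm.mp hC); have := right_ne_zero hBC
  have := character_ne_zero χ A
  have := character_ne_zero χ B; have := character_ne_zero ψ B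
  have := character_ne_zero ψ C
  have := character_ne_zero χ e; have := character_ne_zero ψ e
  linear_combination (norm := (field_simp; ring))
    (1 / (S.left (e - A) * S.right (e - C) * S.left (A + B - e) * S.right (B + C - e) *
      S.left (B - e) * S.right (B - e) * S.left (A + C - e) * S.right (A + C - e) *
      S.sigma (x + B) * S.sigma (y + A) * S.sigma (x + y + A) * χ C * ψ A)) * weierstrass

theorem yangBaxter_entry_two_zero
    (hB : S.sigma (B - e) ≠ 0) (hC : S.sigma (C - e) ≠ 0)
    (hAB : S.sigma (A + B - e) ≠ 0) (hAC : S.sigma (A + C - e) ≠ 0) :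
    S.bottomLeft A C (e - B) (χ * ψ) (x + y) * S.bottomLeft A B e ψ y =
      S.bottomLeft A B (e - C) ψ y * S.bottomLeft A C e (χ * ψ) (x + y) := by
  have := right_ne_zero (sigma_sub_ne_zero_comm.mp hB)
  have := right_ne_zero (sigma_sub_ne_zero_comm.mp hC)
  have := left_ne_zero hAB; have := left_ne_zero hAC
  have prefactor_eq :
      S.left (A + B + C - e) * S.right (e - B) / (S.left (A + B - e) * S.right (e - B - C)) *
        (S.left (A + B - e) * S.right e / (S.left (A - e) * S.right (e - B))) =
      S.left (A + B + C - e) * S.right (e - C) / (S.left (A + C - e) * S.right (e - B - C)) *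
        (S.left (A + C - e) * S.right e / (S.left (A - e) * S.right (e - C))) := by
    field_simp
  simp only [bottomLeft, sub_sub_eq_add_sub, add_right_comm A C B, sub_right_comm e C B]
  linear_combination S.sigma (y + A - B) / S.sigma (y + A) *
    (S.sigma (x + y + A - C) / S.sigma (x + y + A)) * (χ * ψ) (-C) * ψ (-B) * prefactor_eq

theorem topLeft_eq_swap : S.topLeft A B e χ x = S.swap.bottomRight A B (A + B - e) χ x := by
  simp only [topLeft, bottomRight, swap_sigma, swap_left, swap_right]
  rw [show A + B - e - A = B - e by abel, show A + B - e - B = A - e by abel,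
    show x + (A + B - e) - B = x + A - e by abel, show B - e - B = -e by abel]
  ring

theorem topRight_eq_swap : S.topRight A B e χ x = S.swap.topRight A B (A + B - e) χ x := by
  simp only [topRight, swap_sigma, swap_left, swap_right]
  rw [sub_sub_cancel, show B - (A + B - e) = e - A by abel, show A + B - e - A = B - e by abel]
  ring

theorem bottomLeft_eq_swap : S.bottomLeft A B e χ x = S.swap.bottomLeft A B (A + B - e) χ x := by
  simp only [bottomLeft, swap_sigma, swap_left, swap_right]
  rw [sub_sub_cancel, show A - (A + B - e) = e - B by abel, add_sub_right_comm,
    add_sub_cancel_right]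
  ring

theorem bottomRight_eq_swap : S.bottomRight A B e χ x = S.swap.topLeft A B (A + B - e) χ x := by
  simp only [topLeft, bottomRight, swap_sigma, swap_left, swap_right]
  rw [show A - (A + B - e) = e - B by abel, show B - (A + B - e) = e - A by abel,
    show x + A - (A + B - e) = x + e - B by abel, show -(A + B - e) = e - A - B by abel]
  ring

theorem sigma_ne_zero_of_add_eq_zero {z w : G} (h : z + w = 0) (hw : S.sigma w ≠ 0) :
    S.sigma z ≠ 0 := by
  rwa [eq_neg_of_add_eq_zero_left h, S.sigma_neg, neg_ne_zero]

theorem yangBaxter_entry_one_two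
    (hyA : S.sigma (y + A) ≠ 0) (hxyA : S.sigma (x + y + A) ≠ 0) (hA : S.sigma (A - e) ≠ 0)
    (hB : S.sigma (B - e) ≠ 0) (hC : S.sigma (C - e) ≠ 0) (hAC : S.sigma (A + C - e) ≠ 0) :
    S.bottomRight B C e χ x * S.topRight A C (e - B) (χ * ψ) (x + y) =
      S.topLeft A B (e - C) ψ y * S.bottomRight A C e (χ * ψ) (x + y) *
          S.topRight B C (e - A) χ x +
        S.topRight A B (e - C) ψ y * S.bottomRight B C (e - A) χ x := by
  have entry := yangBaxter_entry_zero_one (S := S.swap) (B := B) (C := C)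
    (e := A + B + C - e) (χ := χ) (ψ := ψ) hyA hxyA (sigma_ne_zero_of_add_eq_zero (by abel) hAC)
    (sigma_ne_zero_of_add_eq_zero (by abel) hC) (sigma_ne_zero_of_add_eq_zero (by abel) hB)
    (sigma_ne_zero_of_add_eq_zero (by abel) hA)
  simp only [bottomRight_eq_swap (S := S), topRight_eq_swap (S := S), topLeft_eq_swap (S := S)]
  rw [show B + C - e = A + B + C - e - A by abel, show A + C - (e - B) = A + B + C - e by abel,
    show A + B - (e - C) = A + B + C - e by abel, show B + C - (e - A) = A + B + C - e by abel,
    show A + C - e = A + B + C - e - B by abel]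
  linear_combination -entry

theorem yangBaxter_entry_two_one
    (hxB : S.sigma (x + B) ≠ 0) (hxyA : S.sigma (x + y + A) ≠ 0) (hA : S.sigma (A - e) ≠ 0)
    (hB : S.sigma (B - e) ≠ 0) (hC : S.sigma (C - e) ≠ 0) (hAC : S.sigma (A + C - e) ≠ 0) :
    S.bottomLeft A C (e - B) (χ * ψ) (x + y) * S.bottomRight A B e ψ y =
      S.bottomLeft A B (e - C) ψ y * S.bottomRight A C e (χ * ψ) (x + y) *
          S.topLeft B C (e - A) χ x +
        S.bottomRight A B (e - C) ψ y * S.bottomLeft B C (e - A) χ x := by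
  have entry := yangBaxter_entry_one_zero (S := S.swap) (B := B) (C := C)
    (e := A + B + C - e) (χ := χ) (ψ := ψ) hxB hxyA (sigma_ne_zero_of_add_eq_zero (by abel) hAC)
    (sigma_ne_zero_of_add_eq_zero (by abel) hC) (sigma_ne_zero_of_add_eq_zero (by abel) hB)
    (sigma_ne_zero_of_add_eq_zero (by abel) hA)
  simp only [bottomRight_eq_swap (S := S), bottomLeft_eq_swap (S := S), topLeft_eq_swap (S := S)]
  rw [show A + B - e = A + B + C - e - C by abel, show A + C - (e - B) = A + B + C - e by abel,
    show A + B - (e - C) = A + B + C - e by abel, show B + C - (e - A) = A + B + C - e by abel,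
    show A + C - e = A + B + C - e - B by abel]
  linear_combination -entry

theorem yangBaxter_entry_two_two
    (hxB : S.sigma (x + B) ≠ 0) (hyA : S.sigma (y + A) ≠ 0) (hxyA : S.sigma (x + y + A) ≠ 0)
    (hA : S.sigma (A - e) ≠ 0) (hC : S.sigma (C - e) ≠ 0) (hAC : S.sigma (A + C - e) ≠ 0) :
    S.bottomRight A C (e - B) (χ * ψ) (x + y) =
      S.bottomLeft A B (e - C) ψ y * S.bottomRight A C e (χ * ψ) (x + y) *
          S.topRight B C (e - A) χ x +
        S.bottomRight A B (e - C) ψ y * S.bottomRight B C (e - A) χ x := by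
  have entry := yangBaxter_entry_zero_zero (S := S.swap) (B := B) (C := C)
    (e := A + B + C - e) (χ := χ) (ψ := ψ) hxB hyA hxyA (sigma_ne_zero_of_add_eq_zero (by abel) hAC)
    (sigma_ne_zero_of_add_eq_zero (by abel) hC) (sigma_ne_zero_of_add_eq_zero (by abel) hA)
  simp only [bottomRight_eq_swap (S := S), bottomLeft_eq_swap (S := S), topRight_eq_swap (S := S)]
  rw [show A + C - (e - B) = A + B + C - e by abel,
    show A + B - (e - C) = A + B + C - e by abel, show B + C - (e - A) = A + B + C - e by abel,
    show A + C - e = A + B + C - e - B by abel]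
  linear_combination -entry

variable (S) in
/-- The nontrivial `2 × 2` block of the matrix `S̃_r`, for an arbitrary factored sigma function. -/
def block (b₀ b₁ e : G) (χ : AddChar G K) (x : G) : Matrix (Fin 2) (Fin 2) K :=
  !![S.topLeft b₀ b₁ e χ x, S.topRight b₀ b₁ e χ x;
    S.bottomLeft b₀ b₁ e χ x, S.bottomRight b₀ b₁ e χ x]

end FactoredSigma

/-- The extension of a matrix by the identity along an injection `f` of its index type into `n`. -/
def extendByOne {m n R : Type*} [Fintype m] [DecidableEq m] [DecidableEq n] [Ring R] (f : m → n)
    (F : Matrix m m R) : Matrix n n R :=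
  1 + (1 : Matrix n n R).submatrix id f * (F - 1) * (1 : Matrix n n R).submatrix f id

section ExtendByOne

variable {l m n R : Type*} [Fintype l] [DecidableEq l] [Fintype m] [DecidableEq m]
  [DecidableEq n] [Ring R]

theorem extendByOne_mul [Fintype n] {f : m → n} (hf : Function.Injective f) (F F' : Matrix m m R) :
    extendByOne f (F * F') = extendByOne f F * extendByOne f F' := by
  have h : (1 : Matrix n n R).submatrix f id * (1 : Matrix n n R).submatrix id f = 1 := by
    rw [← Matrix.submatrix_mul _ _ _ _ _ Function.bijective_id, one_mul, Matrix.submatrix_one f hf]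
  simp only [extendByOne]
  generalize (1 : Matrix n n R).submatrix f id = J' at *
  generalize (1 : Matrix n n R).submatrix id f = J at *
  have cross_term : J * (F - 1) * J' * (J * (F' - 1) * J') = J * ((F - 1) * (F' - 1)) * J' := by
    rw [← Matrix.mul_assoc, ← Matrix.mul_assoc, Matrix.mul_assoc _ J' J, h, Matrix.mul_one,
      Matrix.mul_assoc J]
  have mul_sub_one : F * F' - 1 = (F - 1) + (F' - 1) + (F - 1) * (F' - 1) := by noncomm_ring
  rw [mul_sub_one, Matrix.mul_add, Matrix.mul_add, Matrix.add_mul, Matrix.add_mul, ← cross_term]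
  noncomm_ring

theorem extendByOne_comp (f : m → n) (g : l → m) (F : Matrix l l R) :
    extendByOne f (extendByOne g F) = extendByOne (f ∘ g) F := by
  have h : (1 : Matrix n n R).submatrix id f * (1 : Matrix m m R).submatrix id g =
      (1 : Matrix n n R).submatrix id (f ∘ g) := Matrix.mul_submatrix_one (Equiv.refl m) g _
  have h' : (1 : Matrix m m R).submatrix g id * (1 : Matrix n n R).submatrix f id =
      (1 : Matrix n n R).submatrix (f ∘ g) id := Matrix.one_submatrix_mul g (Equiv.refl m) _
  rw [extendByOne, extendByOne, extendByOne, add_sub_cancel_left, ← h, ← h']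
  simp only [Matrix.mul_assoc]

theorem extendByOne_castSucc (F : Matrix (Fin 2) (Fin 2) R) :
    extendByOne (n := Fin 3) Fin.castSucc F = !![F 0 0, F 0 1, 0; F 1 0, F 1 1, 0; 0, 0, 1] := by
  ext i j
  fin_cases i <;> fin_cases j <;> simp [extendByOne, Matrix.mul_apply, Matrix.one_apply]

theorem extendByOne_succ (F : Matrix (Fin 2) (Fin 2) R) :
    extendByOne (n := Fin 3) Fin.succ F = !![1, 0, 0; 0, F 0 0, F 0 1; 0, F 1 0, F 1 1] := by
  ext i j
  fin_cases i <;> fin_cases j <;> simp [extendByOne, Matrix.mul_apply, Matrix.one_apply]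

end ExtendByOne

theorem FactoredSigma.yangBaxter {G K : Type*} [AddCommGroup G] [Field K] (S : FactoredSigma G K)
    {A B C e x y : G} (χ ψ : AddChar G K)
    (hxB : S.sigma (x + B) ≠ 0) (hyA : S.sigma (y + A) ≠ 0) (hxyA : S.sigma (x + y + A) ≠ 0)
    (hA : S.sigma (A - e) ≠ 0) (hB : S.sigma (B - e) ≠ 0) (hC : S.sigma (C - e) ≠ 0)
    (hAB : S.sigma (A + B - e) ≠ 0) (hAC : S.sigma (A + C - e) ≠ 0)
    (hBC : S.sigma (B + C - e) ≠ 0) :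
    extendByOne (n := Fin 3) Fin.castSucc (S.block B C e χ x) *
        extendByOne (n := Fin 3) Fin.succ (S.block A C (e - B) (χ * ψ) (x + y)) *
        extendByOne (n := Fin 3) Fin.castSucc (S.block A B e ψ y) =
      extendByOne (n := Fin 3) Fin.succ (S.block A B (e - C) ψ y) *
        extendByOne (n := Fin 3) Fin.castSucc (S.block A C e (χ * ψ) (x + y)) *
        extendByOne (n := Fin 3) Fin.succ (S.block B C (e - A) χ x) := by
  simp only [extendByOne_castSucc, extendByOne_succ, Matrix.mul_fin_three, mul_zero, zero_mul,
    mul_one, one_mul, add_zero, zero_add]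
  ext i j
  fin_cases i <;> fin_cases j
  · exact yangBaxter_entry_zero_zero hxB hyA hxyA hB hAB hBC
  · exact yangBaxter_entry_zero_one hyA hxyA hB hAB hAC hBC
  · exact yangBaxter_entry_zero_two hA hB hAC hBC
  · exact yangBaxter_entry_one_zero hxB hxyA hB hAB hAC hBC
  · exact yangBaxter_entry_one_one hxyA hA hB hC hAB hAC hBC
  · exact yangBaxter_entry_one_two hyA hxyA hA hB hC hAC
  · exact yangBaxter_entry_two_zero hB hC hAB hAC
  · exact yangBaxter_entry_two_one hxB hxyA hA hB hC hAC
  · exact yangBaxter_entry_two_two hxB hyA hxyA hA hC hAC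

section Windows

/-- The inclusion of `k` consecutive positions, starting at `r`. -/
def window {k M : ℕ} (r : ℕ) (h : r + k ≤ M) (i : Fin k) : Fin M :=
  ⟨r + i, by omega⟩

theorem window_injective {k M : ℕ} (r : ℕ) (h : r + k ≤ M) : Function.Injective (window r h) :=
  fun i j hij => Fin.ext (by simpa [window] using hij)

theorem window_comp_castSucc {k M : ℕ} (r : ℕ) (h : r + (k + 1) ≤ M) :
    window r h ∘ Fin.castSucc = window r (by omega) :=
  rfl

theorem window_comp_succ {k M : ℕ} (r : ℕ) (h : r + (k + 1) ≤ M) :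
    window r h ∘ Fin.succ = window (r + 1) (by omega) := by
  ext i
  simp only [window, Function.comp_apply, Fin.val_succ]
  omega

theorem eq_extendByOne {m n R : Type*} [Fintype m] [DecidableEq m] [DecidableEq n] [Ring R]
    {f : m → n} (hf : Function.Injective f) {F : Matrix m m R} {F' : Matrix n n R}
    (h : ∀ i j, F' (f i) (f j) = F i j)
    (h_left : ∀ i j, i ∉ Set.range f → F' i j = (1 : Matrix n n R) i j)
    (h_right : ∀ i j, j ∉ Set.range f → F' i j = (1 : Matrix n n R) i j) :
    F' = extendByOne f F := by
  ext i j
  by_cases hi : i ∈ Set.range f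
  · by_cases hj : j ∈ Set.range f
    · obtain ⟨⟨k, rfl⟩, ⟨l, rfl⟩⟩ := hi, hj
      simp [h, extendByOne, Matrix.mul_apply, Matrix.one_apply, hf.eq_iff]
    · have (k : m) : f k ≠ j := fun hk => hj ⟨k, hk⟩
      simp [h_right i j hj, extendByOne, Matrix.mul_apply, Matrix.one_apply, this]
  · have (k : m) : i ≠ f k := fun hk => hi ⟨k, hk.symm⟩
    simp [h_left i j hi, extendByOne, Matrix.mul_apply, Matrix.one_apply, this]

end Windows

section Reduction

variable {r M : ℕ} {lq : ℂ} (hq : ‖exp lq‖ < 1) (β : Fin M → ℂ) (γ : ℂ)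

/-- The sigma function `q ^ (-z / 2) θ(q ^ z)`, whose factors come from the two shifted factorials
of `θ`. -/
noncomputable def qSigma : FactoredSigma ℂ ℂ where
  sigma := sigmaTheta lq
  left := sigmaLeft lq
  right := sigmaRight lq
  left_mul_right _ := rfl
  sigma_neg := sigmaTheta_neg hq
  three_term := sigmaTheta_three_term hq

/-- The character `δ ↦ u ^ δ`, where `x` is the chosen value of `log u`. -/
noncomputable def qPowChar (x : ℂ) : AddChar ℂ ℂ where
  toFun := qPow x
  map_zero_eq_one' := qPow_zero x
  map_add_eq_mul' := qPow_add x

theorem qPowChar_mul (x y : ℂ) : qPowChar x * qPowChar y = qPowChar (x + y) := by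
  ext δ
  simp only [AddChar.mul_apply, qPowChar, AddChar.coe_mk, qPow, add_mul, exp_add]

theorem sigma_entry_eq_qPoch_mul_qTheta {a b z w : ℂ} (a' b' : ℂ) (h : a + z = b + w) :
    sigmaLeft lq a * sigmaRight lq a' / (sigmaLeft lq b * sigmaRight lq b') *
        (sigmaTheta lq z / sigmaTheta lq w) =
      qPoch (exp lq) (qPow lq a) * qPoch (exp lq) (qPow lq (1 - a')) /
          (qPoch (exp lq) (qPow lq b) * qPoch (exp lq) (qPow lq (1 - b'))) *
        (qTheta (exp lq) (qPow lq z) / qTheta (exp lq) (qPow lq w)) := by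
  have half_powers : qPow lq (-a / 2) * qPow lq (w / 2) = qPow lq (-b / 2) * qPow lq (z / 2) := by
    rw [← qPow_add, ← qPow_add, show -a / 2 + w / 2 = -b / 2 + z / 2 by linear_combination -h / 2]
  have half_powers_div : qPow lq (-a / 2) / qPow lq (-b / 2) =
      qPow lq (z / 2) / qPow lq (w / 2) := by
    rw [div_eq_div_iff (qPow_ne_zero _ _) (qPow_ne_zero _ _), half_powers, mul_comm]
  simp only [qTheta_qPow_eq_mul_sigmaTheta, sigmaLeft, sigmaRight, mul_assoc, mul_div_mul_comm,
    half_powers_div]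
  ring

/-- The exponent of `q b_r ⋯ b_M / c`. -/
noncomputable def tailExponent (r : Fin M) : ℂ :=
  1 + ∑ i ∈ Finset.Ici r, β i - γ

theorem tailExponent_comp_perm {r : Fin M} {σ : Equiv.Perm (Fin M)} (hσ : ∀ i, r ≤ σ i ↔ r ≤ i) :
    tailExponent (fun i => β (σ i)) γ r = tailExponent β γ r := by
  rw [tailExponent, tailExponent, Finset.sum_equiv σ (t := Finset.Ici r) (g := β)] <;> simp [hσ]

theorem Ici_eq_insert_Ici (hr : r + 1 < M) :
    Finset.Ici (⟨r, by omega⟩ : Fin M) = insert ⟨r, by omega⟩ (Finset.Ici ⟨r + 1, hr⟩) := by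
  ext i
  simp only [Finset.mem_insert, Finset.mem_Ici, Fin.le_def, Fin.ext_iff]
  omega

theorem tailExponent_succ (hr : r + 1 < M) :
    tailExponent β γ ⟨r + 1, hr⟩ = tailExponent β γ ⟨r, by omega⟩ - β ⟨r, by omega⟩ := by
  rw [tailExponent, tailExponent, Ici_eq_insert_Ici hr, Finset.sum_insert (by simp)]
  ring

theorem tailExponent_eq_add_sum (hr : r + 1 < M) :
    tailExponent β γ ⟨r, by omega⟩ =
      1 + (β ⟨r, by omega⟩ + (β ⟨r + 1, hr⟩ + ∑ i : Fin M with r + 1 < i.val, β i)) - γ := by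
  rw [tailExponent, Ici_eq_insert_Ici hr, Finset.sum_insert (by simp), ← Finset.Ioi_insert,
    Finset.sum_insert (by simp), ← Finset.filter_lt_eq_Ioi]
  rfl

theorem STilde_apply_window (hr : r + 1 < M) (x : ℂ) (i j : Fin 2) :
    STilde lq β γ r hr x (window (k := 2) r hr i) (window (k := 2) r hr j) =
      (qSigma hq).block (β ⟨r, by omega⟩) (β ⟨r + 1, hr⟩) (tailExponent β γ ⟨r, by omega⟩)
        (qPowChar x) (x / lq) i j := by
  have base : exp lq = qPow lq 1 := (qPow_one lq).symm
  have base_sq : qPow lq 1 ^ 2 = qPow lq 2 := by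
    rw [qPow_one]
    exact_mod_cast (qPow_natCast lq 2).symm
  have power (δ : ℂ) : exp (δ * x) = qPow x δ := by rw [qPow, mul_comm]
  rw [tailExponent_eq_add_sum β γ hr]
  fin_cases i <;> fin_cases j
  all_goals
    simp only [STilde, window, Matrix.of_apply, power, FactoredSigma.block, FactoredSigma.topLeft,
      FactoredSigma.topRight, FactoredSigma.bottomLeft, FactoredSigma.bottomRight, Fin.zero_eta,
      Fin.mk_one, Fin.isValue, Matrix.cons_val, add_zero, Nat.add_eq_left, Nat.left_eq_add,
      one_ne_zero, and_self, and_true, and_false, if_true, if_false]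
    simp only [qSigma, qPowChar, AddChar.coe_mk]
    rw [sigma_entry_eq_qPoch_mul_qTheta _ _ (by ring)]
    simp only [base, base_sq, ← qPow_div_self hq, ← qPow_sum, ← qPow_add, ← qPow_sub]
    ring_nf

theorem STilde_eq_extendByOne (hr : r + 1 < M) (x : ℂ) :
    STilde lq β γ r hr x = extendByOne (window (k := 2) r hr)
      ((qSigma hq).block (β ⟨r, by omega⟩) (β ⟨r + 1, hr⟩) (tailExponent β γ ⟨r, by omega⟩)
        (qPowChar x) (x / lq)) := by
  apply eq_extendByOne (window_injective r hr)
  · exact STilde_apply_window hq β γ hr x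
  · intro i j hi
    have h₀ : i.val ≠ r := fun h => hi ⟨0, Fin.ext h.symm⟩
    have h₁ : i.val ≠ r + 1 := fun h => hi ⟨1, Fin.ext h.symm⟩
    simp [STilde, h₀, h₁, Matrix.one_apply]
  · intro i j hj
    have h₀ : j.val ≠ r := fun h => hj ⟨0, Fin.ext h.symm⟩
    have h₁ : j.val ≠ r + 1 := fun h => hj ⟨1, Fin.ext h.symm⟩
    simp [STilde, h₀, h₁, Matrix.one_apply]

theorem STilde_eq_extendByOne_castSucc (hr : r + 2 < M) (x : ℂ) :
    STilde lq β γ r (by omega) x = extendByOne (window (k := 3) r hr) (extendByOne Fin.castSucc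
      ((qSigma hq).block (β ⟨r, by omega⟩) (β ⟨r + 1, by omega⟩)
        (tailExponent β γ ⟨r, by omega⟩) (qPowChar x) (x / lq))) := by
  rw [extendByOne_comp, window_comp_castSucc, STilde_eq_extendByOne hq]

theorem STilde_succ_eq_extendByOne_succ (hr : r + 2 < M) (x : ℂ) :
    STilde lq β γ (r + 1) hr x = extendByOne (window (k := 3) r hr) (extendByOne Fin.succ
      ((qSigma hq).block (β ⟨r + 1, by omega⟩) (β ⟨r + 2, hr⟩)
        (tailExponent β γ ⟨r, by omega⟩ - β ⟨r, by omega⟩) (qPowChar x) (x / lq))) := by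
  rw [extendByOne_comp, window_comp_succ, STilde_eq_extendByOne hq, tailExponent_succ]

theorem qSigma_sum_sub_tailExponent_ne_zero (hr : r + 2 < M)
    (hc : ∀ I : Finset (Fin M), Finset.Ioi ⟨r + 2, hr⟩ ⊂ I → I ⊂ Finset.Ici ⟨r, by omega⟩ →
      ∀ n : ℤ, qPow lq γ / ∏ i ∈ I, qPow lq (β i) ≠ exp lq ^ n)
    {J : Finset (Fin 3)} (hJ : J ≠ ∅) (hJ' : J ≠ Finset.univ) :
    (qSigma hq).sigma (∑ j ∈ J, β (window r hr j) - tailExponent β γ ⟨r, by omega⟩) ≠ 0 := by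
  have inj : Function.Injective (window r hr) := window_injective (k := 3) r hr
  have image_subset : J.image (window r hr) ⊆ Finset.Ici ⟨r, by omega⟩ := by
    intro i hi
    obtain ⟨j, -, rfl⟩ := Finset.mem_image.mp hi
    simp [window, Fin.le_def]
  obtain ⟨j, hj⟩ : ∃ j, j ∉ J := by simpa [Finset.eq_univ_iff_forall] using hJ'
  have tail_ssubset : Finset.Ioi ⟨r + 2, hr⟩ ⊂
      Finset.Ici ⟨r, by omega⟩ \ J.image (window r hr) := by
    refine (Finset.ssubset_iff_of_subset fun i hi => ?_).mpr ⟨window r hr j, ?_, ?_⟩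
    · rw [Finset.mem_Ioi, Fin.lt_def] at hi
      refine Finset.mem_sdiff.mpr
        ⟨Finset.mem_Ici.mpr (Fin.le_def.mpr (by dsimp only at hi ⊢; omega)), fun hi' => ?_⟩
      obtain ⟨j, -, rfl⟩ := Finset.mem_image.mp hi'
      simp only [window] at hi
      omega
    · exact Finset.mem_sdiff.mpr
        ⟨by simp [window, Fin.le_def], fun h => hj (inj.mem_finset_image.mp h)⟩
    · simp only [window, Finset.mem_Ioi, Fin.lt_def]
      omega
  refine sigmaTheta_ne_zero hq fun n hn => hc _ tail_ssubset
    (Finset.sdiff_ssubset image_subset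
      ((Finset.nonempty_iff_ne_empty.mpr hJ).image _)) (n + 1) ?_
  have exponent : γ - ∑ i ∈ Finset.Ici ⟨r, by omega⟩ \ J.image (window r hr), β i =
      ∑ j ∈ J, β (window r hr j) - tailExponent β γ ⟨r, by omega⟩ + 1 := by
    rw [tailExponent, ← Finset.sum_sdiff image_subset, Finset.sum_image inj.injOn]
    ring
  rw [← qPow_sum, ← qPow_sub, exponent, qPow_add, hn, qPow_one, zpow_add_one₀ (exp_ne_zero _)]

theorem qSigma_sub_tailExponent_ne_zero (hr : r + 2 < M)
    (hc : ∀ I : Finset (Fin M), Finset.Ioi ⟨r + 2, hr⟩ ⊂ I → I ⊂ Finset.Ici ⟨r, by omega⟩ →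
      ∀ n : ℤ, qPow lq γ / ∏ i ∈ I, qPow lq (β i) ≠ exp lq ^ n)
    (j : Fin 3) : (qSigma hq).sigma (β (window r hr j) - tailExponent β γ ⟨r, by omega⟩) ≠ 0 := by
  simpa using qSigma_sum_sub_tailExponent_ne_zero hq β γ hr hc
    (Finset.singleton_ne_empty j) (by revert j; decide)

theorem qSigma_add_sub_tailExponent_ne_zero (hr : r + 2 < M)
    (hc : ∀ I : Finset (Fin M), Finset.Ioi ⟨r + 2, hr⟩ ⊂ I → I ⊂ Finset.Ici ⟨r, by omega⟩ →
      ∀ n : ℤ, qPow lq γ / ∏ i ∈ I, qPow lq (β i) ≠ exp lq ^ n)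
    {j k : Fin 3} (hjk : j ≠ k) :
    (qSigma hq).sigma
      (β (window r hr j) + β (window r hr k) - tailExponent β γ ⟨r, by omega⟩) ≠ 0 := by
  simpa [hjk] using qSigma_sum_sub_tailExponent_ne_zero hq β γ hr hc
    (Finset.insert_ne_empty j {k}) (by revert j k; decide)

theorem qSigma_div_add_ne_zero {z w : ℂ} (h : ∀ n : ℤ, exp z * qPow lq w ≠ exp lq ^ n) :
    (qSigma hq).sigma (z / lq + w) ≠ 0 :=
  sigmaTheta_ne_zero hq (by simpa only [qPow_add, qPow_div_self hq] using h)

end Reduction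

section AdjacentTranspositions

variable {r M : ℕ} (hr : r + 1 < M)

theorem adjSwap_left {h : r < M} : adjSwap r hr ⟨r, h⟩ = ⟨r + 1, hr⟩ :=
  Equiv.swap_apply_left _ _

theorem adjSwap_right {h : r + 1 < M} : adjSwap r hr ⟨r + 1, h⟩ = ⟨r, by omega⟩ :=
  Equiv.swap_apply_right _ _

theorem adjSwap_of_lt {k : ℕ} (hk : k < r) {h : k < M} : adjSwap r hr ⟨k, h⟩ = ⟨k, h⟩ :=
  Equiv.swap_apply_of_ne_of_ne (Fin.ne_of_val_ne hk.ne)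
    (Fin.ne_of_val_ne (Nat.lt_succ_of_lt hk).ne)

theorem adjSwap_of_gt {k : ℕ} (hk : r + 1 < k) {h : k < M} : adjSwap r hr ⟨k, h⟩ = ⟨k, h⟩ :=
  Equiv.swap_apply_of_ne_of_ne (Fin.ne_of_val_ne (Nat.lt_of_succ_lt hk).ne')
    (Fin.ne_of_val_ne hk.ne')

theorem tailExponent_adjSwap {k : ℕ} (hk : k ≤ r) {h : k < M} (β : Fin M → ℂ) (γ : ℂ) :
    tailExponent (fun i => β (adjSwap r hr i)) γ ⟨k, h⟩ = tailExponent β γ ⟨k, h⟩ := by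
  refine tailExponent_comp_perm β γ fun i => ?_
  rw [adjSwap, Equiv.swap_apply_def]
  split_ifs with h h' <;> simp only [Fin.ext_iff, Fin.le_def] at * <;> omega

end AdjacentTranspositions

theorem mainTheorem4_general {r M : ℕ} (hr : r + 2 < M)
    (q lq : ℂ) (hlq : Complex.exp lq = q) (hq : ‖q‖ < 1)
    (β : Fin M → ℂ) (γ : ℂ)
    (hc : ∀ I : Finset (Fin M), Finset.Ioi ⟨r + 2, hr⟩ ⊂ I → I ⊂ Finset.Ici ⟨r, by omega⟩ →
      ∀ n : ℤ, qPow lq γ / ∏ i ∈ I, qPow lq (β i) ≠ q ^ n)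
    (u v x y : ℂ) (hu : Complex.exp x = u) (hv : Complex.exp y = v)
    (hu_pole : ∀ n : ℤ, u * qPow lq (β ⟨r + 1, by omega⟩) ≠ q ^ n)
    (hv_pole : ∀ n : ℤ, v * qPow lq (β ⟨r, by omega⟩) ≠ q ^ n)
    (huv_pole : ∀ n : ℤ, u * v * qPow lq (β ⟨r, by omega⟩) ≠ q ^ n) :
    STilde lq
        (fun i => β (adjSwap r (by omega) (adjSwap (r + 1) (by omega) i))) γ r (by omega) x *
      STilde lq (fun i => β (adjSwap r (by omega) i)) γ (r + 1) (by omega) (x + y) *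
      STilde lq β γ r (by omega) y =
    STilde lq
        (fun i => β (adjSwap (r + 1) (by omega) (adjSwap r (by omega) i))) γ (r + 1) (by omega) y *
      STilde lq (fun i => β (adjSwap (r + 1) (by omega) i)) γ r (by omega) (x + y) *
      STilde lq β γ (r + 1) (by omega) x := by
  subst hlq hu hv
  rw [← exp_add] at huv_pole
  simp only [STilde_eq_extendByOne_castSucc hq _ γ hr, STilde_succ_eq_extendByOne_succ hq _ γ hr,
    ← extendByOne_mul (window_injective (k := 3) r hr), ← qPowChar_mul]
  have hr' : r + 1 < M := Nat.lt_of_succ_lt hr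
  simp only [add_div, tailExponent_adjSwap hr' le_rfl β,
    tailExponent_adjSwap hr (Nat.le_succ r) β,
    tailExponent_adjSwap hr' le_rfl fun i => β (adjSwap (r + 1) hr i),
    tailExponent_adjSwap hr (Nat.le_succ r) fun i => β (adjSwap r hr' i), adjSwap_left,
    adjSwap_right, adjSwap_of_lt hr (Nat.lt_succ_self r),
    adjSwap_of_gt hr' (Nat.lt_succ_self (r + 1))]
  have generic := qSigma_sub_tailExponent_ne_zero hq β γ hr hc
  have generic_pair (j k : Fin 3) (hjk : j ≠ k) :=
    qSigma_add_sub_tailExponent_ne_zero hq β γ hr hc hjk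
  exact congrArg _ (FactoredSigma.yangBaxter _ _ _ (qSigma_div_add_ne_zero hq hu_pole)
    (qSigma_div_add_ne_zero hq hv_pole)
    (by simpa only [add_div] using qSigma_div_add_ne_zero hq huv_pole)
    (generic 0) (generic 1) (generic 2) (generic_pair 0 1 (by decide))
    (generic_pair 0 2 (by decide)) (generic_pair 1 2 (by decide)))

theorem mainTheorem4 {M : ℕ} (r : ℕ) (hr : r + 2 < M)
    (q lq : ℂ) (hlq : Complex.exp lq = q) (hq : ‖q‖ < 1)
    (β : Fin M → ℂ) (γ : ℂ)
    (hc : ∀ (I : Finset (Fin M)) (n : ℤ), qPow lq γ / ∏ i ∈ I, qPow lq (β i) ≠ q ^ n)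
    (u v x y : ℂ) (hu : Complex.exp x = u) (hv : Complex.exp y = v)
    (hu_pole : ∀ n : ℤ, u * qPow lq (β ⟨r + 1, by omega⟩) ≠ q ^ n)
    (hv_pole : ∀ n : ℤ, v * qPow lq (β ⟨r, by omega⟩) ≠ q ^ n)
    (huv_pole : ∀ n : ℤ, u * v * qPow lq (β ⟨r, by omega⟩) ≠ q ^ n) :
    STilde lq
        (fun i => β (adjSwap r (by omega) (adjSwap (r + 1) (by omega) i))) γ r (by omega) x *
      STilde lq (fun i => β (adjSwap r (by omega) i)) γ (r + 1) (by omega) (x + y) *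
      STilde lq β γ r (by omega) y =
    STilde lq
        (fun i => β (adjSwap (r + 1) (by omega) (adjSwap r (by omega) i))) γ (r + 1) (by omega) y *
      STilde lq (fun i => β (adjSwap (r + 1) (by omega) i)) γ r (by omega) (x + y) *
      STilde lq β γ (r + 1) (by omega) x :=
  mainTheorem4_general hr q lq hlq hq β γ (fun I _ _ => hc I) u v x y hu hv hu_pole hv_pole
    huv_pole
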